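/- Let $X$ be a complex Banach space and $L(X)$ the algebra of bounded linear operators on $X$. For $A\subset\mathbb{C}$ let $\mathrm{acc}\,A$ be the set of accumulation points of $A$, and define by transfinite recursion $\mathrm{acc}^{0}A=A$, $\mathrm{acc}^{\alpha+1}A=\mathrm{acc}(\mathrm{acc}^{\alpha}A)$ and $\mathrm{acc}^{\alpha}A=\bigcap_{\beta<\alpha}\mathrm{acc}^{\beta}A$ if $\alpha$ is a limit ordinal. Let $\sigma_*$ be one of the spectrum $\sigma$, the Browder spectrum $\sigma_b$, the Drazin spectrum $\sigma_d$, where $\sigma_b(T)$ (resp. $\sigma_d(T)$) is the set of $\lambda\in\mathbb{C}$ such that $T-\lambda I$ is not Browder (resp. not Drazin invertible); an operator $R$ is Browder if it is Fredholm of finite ascent and finite descent, and it is Drazin invertible if there are a bounded operator $S$ and $k\ge 0$ with $SR=RS$, $SRS=S$ and $R^{k+1}S=R^{k}$. An operator $T\in L(X)$ is called $g^{\alpha}_{\sigma_*}$-invertible, for an ordinal $\alpha$, - if $\alpha=0$: when $0\notin\sigma_*(T)$; - if $\alpha=\beta+1$ is a successor: when there are closed $T$-invariant subspaces $M,N$ with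 $X=M\oplus N$ such that the restriction $T_M$ is invertible in $L(M)$ and $\mathrm{acc}^{\beta}\sigma_*(T_N)\subset\{0\}$; - if $\alpha$ is a (nonzero) limit ordinal: when $T$ is $g^{\beta}_{\sigma_*}$-invertible for some successor ordinal $\beta<\alpha$. **Theorem.** For every $T\in L(X)$, every $\mu\in\mathbb{C}$, every ordinal $\alpha$ and each $\sigma_*\in\{\sigma,\sigma_b,\sigma_d\}$, the operator $T-\mu I$ is $g^{\alpha}_{\sigma_*}$-invertible if and only if $\mu\notin\mathrm{acc}^{\alpha}\sigma_*(T)$. -/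

import Mathlib

noncomputable section

/-- The `α`-th Cantor-Bendixson derivative of a set of complex numbers: `acc⁰ A = A`, `acc^(α+1) A`
is the set of accumulation points of `acc^α A`, and at a limit ordinal one intersects all the
previous derivatives. -/
def accIter (A : Set ℂ) (α : Ordinal) : Set ℂ :=
  Ordinal.limitRecOn (motive := fun _ => Set ℂ) α A
    (fun _ B => derivedSet B)
    (fun o _ B => ⋂ (β : Ordinal) (h : β < o), B β h)

theorem accIter_zero (A : Set ℂ) : accIter A 0 = A :=
  Ordinal.limitRecOn_zero _ _ _

theorem accIter_add_one (A : Set ℂ) (α : Ordinal) :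
    accIter A (α + 1) = derivedSet (accIter A α) :=
  Ordinal.limitRecOn_add_one _ _ _ _

theorem accIter_limit (A : Set ℂ) {α : Ordinal} (hα : Order.IsSuccLimit α) :
    accIter A α = ⋂ (β : Ordinal) (_ : β < α), accIter A β :=
  Ordinal.limitRecOn_limit _ _ _ _ hα

section Operators

variable {X : Type*} [NormedAddCommGroup X] [NormedSpace ℂ X]

/-- `T` has finite ascent: the increasing chain of the kernels of its powers becomes stationary. -/
def HasFiniteAscent (T : X →L[ℂ] X) : Prop :=
  ∃ p : ℕ, (T ^ p).ker = (T ^ (p + 1)).ker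

/-- `T` has finite descent: the decreasing chain of the ranges of its powers becomes stationary. -/
def HasFiniteDescent (T : X →L[ℂ] X) : Prop :=
  ∃ q : ℕ, (T ^ q).range = (T ^ (q + 1)).range

/-- Browder operators: Fredholm operators of finite ascent and finite descent. -/
def IsBrowder (T : X →L[ℂ] X) : Prop :=
  T.IsFredholm ∧ HasFiniteAscent T ∧ HasFiniteDescent T

/-- Drazin invertible operators: there is a bounded `S` commuting with `T` such that `STS = S` and
`T ^ (k + 1) S = T ^ k` for some `k`. -/
def IsDrazinInvertible (T : X →L[ℂ] X) : Prop :=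
  ∃ S : X →L[ℂ] X, Commute S T ∧ S * T * S = S ∧ ∃ k : ℕ, T ^ (k + 1) * S = T ^ k

/-- The three kinds of spectrum: ordinary, Browder and Drazin. -/
inductive SpectrumKind
  | ordinary
  | browder
  | drazin

/-- The spectrum `σ_*(T)`, where `σ_*` is the spectrum, the Browder spectrum or the Drazin
spectrum. -/
def SpectrumKind.spec : SpectrumKind → (X →L[ℂ] X) → Set ℂ
  | .ordinary, T => spectrum ℂ T
  | .browder, T => {z | ¬ IsBrowder (T - z • (1 : X →L[ℂ] X))}
  | .drazin, T => {z | ¬ IsDrazinInvertible (T - z • (1 : X →L[ℂ] X))}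

/-- `T = D ⊕ Q` along closed `T`-invariant subspaces `M`, `N` with `X = M ⊕ N`, where the
restriction `D` of `T` to `M` is invertible in `L(M)` and the restriction `Q` of `T` to `N`
satisfies `acc^β σ_*(Q) ⊆ {0}`. -/
def HasDecomposition (κ : SpectrumKind) (β : Ordinal) (T : X →L[ℂ] X) : Prop :=
  ∃ (M N : Submodule ℂ X) (hM : ∀ x ∈ M, T x ∈ M) (hN : ∀ x ∈ N, T x ∈ N),
    IsClosed (M : Set X) ∧ IsClosed (N : Set X) ∧ IsCompl M N ∧
    IsUnit (T.restrict hM : M →L[ℂ] M) ∧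
    accIter (κ.spec (T.restrict hN : N →L[ℂ] N)) β ⊆ {0}

/-- `T` is `g^α_{σ_*}`-invertible. The three alternatives are exclusive: `α = 0`, `α` is a
successor, `α` is a (nonzero) limit ordinal; in the last case `T` is required to be
`g^(γ+1)_{σ_*}`-invertible for some successor ordinal `γ + 1 < α`. -/
def IsGInvertible (κ : SpectrumKind) (α : Ordinal) (T : X →L[ℂ] X) : Prop :=
  (α = 0 ∧ (0 : ℂ) ∉ κ.spec T) ∨
  (∃ β : Ordinal, α = β + 1 ∧ HasDecomposition κ β T) ∨
  (Order.IsSuccLimit α ∧ ∃ γ : Ordinal, γ + 1 < α ∧ HasDecomposition κ γ T)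

end Operators

end

/-!
Translation reduces everything to `μ = 0`, and since `σ_*(T)` is closed its derivatives decrease, so
only successor ordinals `β + 1` matter.

If `T = D ⊕ Q` with `D` invertible, then near `0` every point of `σ_*(T)` lies in `σ_*(Q)`, so
`acc^β σ_*(T)` is near `0` contained in `acc^β σ_*(Q) ⊆ {0}`. Conversely, let
`0 ∉ acc^(β+1) σ_*(T)`. Every point `z` of `σ(T) ∖ σ_*(T)` is isolated in `σ(T)`, because `T - z` is
Drazin invertible, so a direct sum of an invertible and a nilpotent operator. Hence the perfect
kernel of `σ(T)` lies in `σ_*(T)` and survives in `acc^β σ_*(T)`, which near `0` is at most `{0}`.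
So `σ(T)` is countable near `0`, some arbitrarily small circle around `0` avoids it, and the Riesz
projection for that circle splits `T`.

The Riesz projection of `a` for the unit disc is obtained without contour integrals, as the limit of
`(1 - a ^ 2 ^ k)⁻¹`, that is, of the averages of `(1 - z a)⁻¹` over the roots of unity `z` of order
`2 ^ k`.
-/

open Filter Topology Set

theorem accIter_inter_subset {A B U : Set ℂ} (hU : IsOpen U) (h : A ∩ U ⊆ B) (β : Ordinal) :
    accIter A β ∩ U ⊆ accIter B β := by
  induction β using Ordinal.limitRecOn with
  | zero => simpa only [accIter_zero] using h
  | add_one β ih =>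
    rw [accIter_add_one, accIter_add_one]
    rintro x ⟨hx, hxU⟩
    refine derivedSet_mono _ _ ih ?_
    rw [inter_comm]
    exact AccPt.nhds_inter hx (hU.mem_nhds hxU)
  | limit β hβ ih =>
    rw [accIter_limit _ hβ, accIter_limit _ hβ]
    rintro x ⟨hx, hxU⟩
    simp only [mem_iInter] at hx ⊢
    exact fun γ hγ => ih γ hγ ⟨hx γ hγ, hxU⟩

theorem accIter_mono {A B : Set ℂ} (h : A ⊆ B) (β : Ordinal) : accIter A β ⊆ accIter B β := by
  simpa only [inter_univ] using accIter_inter_subset isOpen_univ (inter_subset_left.trans h) β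

theorem isClosed_accIter {A : Set ℂ} (hA : IsClosed A) (β : Ordinal) :
    IsClosed (accIter A β) := by
  induction β using Ordinal.limitRecOn with
  | zero => rwa [accIter_zero]
  | add_one β _ => rw [accIter_add_one]; exact isClosed_derivedSet _
  | limit β hβ ih =>
    rw [accIter_limit _ hβ]
    exact isClosed_iInter fun γ => isClosed_iInter fun hγ => ih γ hγ

theorem accIter_add_one_subset {A : Set ℂ} (hA : IsClosed A) (β : Ordinal) :
    accIter A (β + 1) ⊆ accIter A β := by
  rw [accIter_add_one]
  exact (isClosed_iff_derivedSet_subset _).1 (isClosed_accIter hA β)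

theorem accIter_subset {A : Set ℂ} (hA : IsClosed A) (β : Ordinal) : accIter A β ⊆ A := by
  induction β using Ordinal.limitRecOn with
  | zero => rw [accIter_zero]
  | add_one β ih => exact (accIter_add_one_subset hA β).trans ih
  | limit β hβ _ =>
    rw [accIter_limit _ hβ]
    exact (iInter₂_subset 0 hβ.bot_lt).trans (accIter_zero A).subset

theorem notMem_accIter_add_one_iff {A : Set ℂ} {c : ℂ} {β : Ordinal} :
    c ∉ accIter A (β + 1) ↔ ∃ U ∈ 𝓝 c, accIter A β ∩ U ⊆ {c} := by
  rw [accIter_add_one, mem_derivedSet, accPt_iff_nhds]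
  push Not
  refine exists_congr fun U => and_congr_right fun _ => ?_
  rw [inter_comm]
  rfl

theorem notMem_accIter_limit_iff {A : Set ℂ} (hA : IsClosed A) {c : ℂ} {α : Ordinal}
    (hα : Order.IsSuccLimit α) :
    c ∉ accIter A α ↔ ∃ γ, γ + 1 < α ∧ c ∉ accIter A (γ + 1) := by
  rw [accIter_limit _ hα, mem_iInter₂]
  push Not
  constructor
  · rintro ⟨γ, hγ, hc⟩
    exact ⟨γ, hα.add_one_lt hγ, fun h => hc (accIter_add_one_subset hA γ h)⟩
  · rintro ⟨γ, hγ, hc⟩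
    exact ⟨γ + 1, hγ, hc⟩

theorem subset_accIter_of_preperfect {A P : Set ℂ} (hP : Preperfect P) (h : P ⊆ A) (β : Ordinal) :
    P ⊆ accIter A β := by
  induction β using Ordinal.limitRecOn with
  | zero => rwa [accIter_zero]
  | add_one β ih =>
    rw [accIter_add_one]
    exact (preperfect_iff_subset_derivedSet.1 hP).trans (derivedSet_mono _ _ ih)
  | limit β hβ ih =>
    rw [accIter_limit _ hβ]
    exact subset_iInter₂ ih

theorem derivedSet_preimage_homeomorph {X Y : Type*} [TopologicalSpace X] [TopologicalSpace Y]
    (e : X ≃ₜ Y) (A : Set Y) : derivedSet (e ⁻¹' A) = e ⁻¹' derivedSet A := by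
  apply Subset.antisymm
  · rw [← image_subset_iff]
    refine (e.continuous.image_derivedSet e.injective).trans ?_
    rw [e.image_preimage]
  · simpa only [e.image_symm] using e.symm.continuous.image_derivedSet (A := A) e.symm.injective

theorem accIter_preimage_homeomorph (e : ℂ ≃ₜ ℂ) (A : Set ℂ) (β : Ordinal) :
    accIter (e ⁻¹' A) β = e ⁻¹' accIter A β := by
  induction β using Ordinal.limitRecOn with
  | zero => simp only [accIter_zero]
  | add_one β ih => rw [accIter_add_one, accIter_add_one, ih, derivedSet_preimage_homeomorph]
  | limit β hβ ih =>
    rw [accIter_limit _ hβ, accIter_limit _ hβ]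
    simp only [preimage_iInter]
    exact iInter₂_congr ih

theorem countable_inter_of_countable_accIter_inter {A C U : Set ℂ} (hC : IsClosed C)
    (hiso : ∀ x ∈ C, x ∉ A → ¬ AccPt x (𝓟 C)) {β : Ordinal} (h : (accIter A β ∩ U).Countable) :
    (C ∩ U).Countable := by
  obtain ⟨V, P, hV, hP, rfl⟩ := exists_countable_union_perfect_of_isClosed hC
  have hPA : P ⊆ A := fun x hx => by
    by_contra hxA
    exact hiso x (Or.inr hx) hxA ((hP.acc x hx).mono (principal_mono.2 subset_union_right))
  rw [union_inter_distrib_right]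
  exact (hV.mono inter_subset_left).union
    (h.mono (inter_subset_inter_left U (subset_accIter_of_preperfect hP.acc hPA β)))

theorem exists_disjoint_sphere_of_countable {X : Type*} [PseudoMetricSpace X] {C : Set X} {c : X}
    {ε : ℝ} (hε : 0 < ε) (hC : (C ∩ Metric.ball c ε).Countable) :
    ∃ r ∈ Ioo 0 ε, Disjoint C (Metric.sphere c r) := by
  obtain ⟨r, hrC, hr⟩ := ((hC.image (dist · c)).dense_compl ℝ).exists_between hε
  refine ⟨r, hr, disjoint_left.2 fun x hx hxr => hrC ⟨x, ⟨hx, ?_⟩, hxr⟩⟩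
  rw [Metric.mem_ball, Metric.mem_sphere.1 hxr]
  exact hr.2

section Idempotent

variable {R : Type*} [Ring R] {e x y x' y' z : R}

theorem mul_idempotent_add_mul (he : IsIdempotentElem e) (hx : Commute e x') (hy : Commute e y') :
    (x * e + y * (1 - e)) * (x' * e + y' * (1 - e)) = x * x' * e + y * y' * (1 - e) := by
  have hx' : Commute (1 - e) x' := (Commute.one_left _).sub_left hx
  have hy' : Commute (1 - e) y' := (Commute.one_left _).sub_left hy
  calc (x * e + y * (1 - e)) * (x' * e + y' * (1 - e))
      = x * (e * x') * e + x * (e * y') * (1 - e) + y * ((1 - e) * x') * e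
        + y * ((1 - e) * y') * (1 - e) := by noncomm_ring
    _ = x * x' * (e * e) + x * y' * (e * (1 - e)) + y * x' * ((1 - e) * e)
        + y * y' * ((1 - e) * (1 - e)) := by
      rw [hx.eq, hy.eq, hx'.eq, hy'.eq]; simp only [mul_assoc]
    _ = x * x' * e + y * y' * (1 - e) := by
      rw [he.eq, he.one_sub.eq, he.mul_one_sub_self, he.one_sub_mul_self, mul_zero, mul_zero,
        add_zero, add_zero]

theorem isUnit_of_mul_idempotent_eq (he : IsIdempotentElem e) (hx : IsUnit x) (hy : IsUnit y)
    (hex : Commute e x) (hey : Commute e y) (hxz : z * e = x * e)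
    (hyz : z * (1 - e) = y * (1 - e)) : IsUnit z := by
  obtain ⟨x, rfl⟩ := hx
  obtain ⟨y, rfl⟩ := hy
  have hz : z = x * e + y * (1 - e) := by rw [← hxz, ← hyz]; noncomm_ring
  rw [hz]
  refine ⟨⟨_, ↑x⁻¹ * e + ↑y⁻¹ * (1 - e), ?_, ?_⟩, rfl⟩
  · rw [mul_idempotent_add_mul he hex.units_inv_right hey.units_inv_right, Units.mul_inv,
      Units.mul_inv, one_mul, one_mul, add_sub_cancel]
  · rw [mul_idempotent_add_mul he hex hey, Units.inv_mul, Units.inv_mul, one_mul, one_mul,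
      add_sub_cancel]

end Idempotent

/-- `s` is a Drazin inverse of `t` in a monoid. A bounded operator `T` is Drazin invertible exactly
when it has a Drazin inverse in the monoid of bounded operators, and the two formulations are
definitionally equal. -/
def IsDrazinInverse {M : Type*} [Monoid M] (t s : M) : Prop :=
  Commute s t ∧ s * t * s = s ∧ ∃ k : ℕ, t ^ (k + 1) * s = t ^ k

namespace IsDrazinInverse

section Monoid

variable {M N : Type*} [Monoid M] [Monoid N] {s t p : M}

theorem isIdempotentElem_mul (h : IsDrazinInverse t s) : IsIdempotentElem (t * s) := by
  rw [IsIdempotentElem, mul_assoc, ← mul_assoc s, h.2.1]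

theorem pow_succ_mul_eq_of_le {k m : ℕ} (hk : t ^ (k + 1) * s = t ^ k) (hkm : k ≤ m) :
    t ^ (m + 1) * s = t ^ m := by
  obtain ⟨d, rfl⟩ := Nat.exists_eq_add_of_le' hkm
  rw [add_assoc, pow_add, mul_assoc, hk, pow_add]

theorem commute_mul (h : IsDrazinInverse t s) (hp : Commute p t) : Commute p (t * s) := by
  have he := h.isIdempotentElem_mul
  obtain ⟨hst, -, k, hk⟩ := h
  have htn : t ^ (k + 1) * (t * s) = t ^ (k + 1) := by
    rw [← mul_assoc, ← pow_succ, pow_succ_mul_eq_of_le hk k.le_succ]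
  have htn' : t * s * t ^ (k + 1) = t ^ (k + 1) := by
    rw [(((Commute.refl t).mul_left hst).pow_right _).eq, htn]
  have hts : t ^ (k + 1) * s ^ (k + 1) = t * s := by
    rw [← hst.symm.mul_pow, he.pow_succ_eq]
  have hst' : s ^ (k + 1) * t ^ (k + 1) = t * s := by
    rw [(hst.pow_pow _ _).eq, hts]
  have hpt := (hp.pow_right (k + 1)).eq
  calc p * (t * s) = t * s * (t ^ (k + 1) * p) * s ^ (k + 1) := by
        rw [← mul_assoc (t * s), htn', ← hpt, mul_assoc, hts]
    _ = t * s * p * (t * s) := by rw [← hpt]; simp only [mul_assoc, hts]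
    _ = s ^ (k + 1) * (p * t ^ (k + 1)) * (t * s) := by rw [hpt, ← mul_assoc (s ^ (k + 1)), hst']
    _ = t * s * p := by rw [mul_assoc, mul_assoc p, htn, hpt, ← mul_assoc, hst']

theorem commute (h : IsDrazinInverse t s) (hp : Commute p t) : Commute p s := by
  have hpe := h.commute_mul hp
  obtain ⟨hst, hs, -⟩ := h
  calc p * s = p * (t * s) * s := by rw [← hst.eq, mul_assoc, hs]
    _ = s * (t * p) * s := by rw [hpe.eq, ← hst.eq, mul_assoc s]
    _ = s * (p * (t * s)) := by rw [← hp.eq]; simp only [mul_assoc]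
    _ = s * p := by rw [hpe.eq, ← mul_assoc, ← mul_assoc, hs]

theorem map {F : Type*} [FunLike F M N] [MonoidHomClass F M N] (h : IsDrazinInverse t s) (f : F) :
    IsDrazinInverse (f t) (f s) := by
  obtain ⟨hst, hs, k, hk⟩ := h
  refine ⟨hst.map f, ?_, k, ?_⟩
  · rw [← map_mul, ← map_mul, hs]
  · rw [← map_pow, ← map_mul, hk, map_pow]

theorem prodMk {t' s' : N} (h : IsDrazinInverse t s) (h' : IsDrazinInverse t' s') :
    IsDrazinInverse (t, t') (s, s') := by
  obtain ⟨hst, hs, k, hk⟩ := h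
  obtain ⟨hst', hs', k', hk'⟩ := h'
  exact ⟨hst.prod hst', Prod.ext hs hs', max k k',
    Prod.ext (pow_succ_mul_eq_of_le hk (le_max_left _ _))
      (pow_succ_mul_eq_of_le hk' (le_max_right _ _))⟩

end Monoid

theorem units_inv {M : Type*} [Monoid M] (u : Mˣ) : IsDrazinInverse (u : M) ↑u⁻¹ :=
  ⟨(Commute.refl _).units_inv_left, by rw [Units.inv_mul, one_mul], 0, by simp⟩

theorem zero_of_isNilpotent {M : Type*} [MonoidWithZero M] {t : M} (h : IsNilpotent t) :
    IsDrazinInverse t 0 := by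
  obtain ⟨k, hk⟩ := h
  exact ⟨Commute.zero_left t, by rw [mul_zero], k, by rw [mul_zero, hk]⟩

section Ring

variable {R : Type*} [Ring R] {s t : R}

theorem isUnit_core (h : IsDrazinInverse t s) : IsUnit (t * (t * s) + (1 - t * s)) := by
  have he := h.isIdempotentElem_mul
  have het : Commute (t * s) t := (Commute.refl t).mul_left h.1
  have hes : Commute (t * s) s := h.1.symm.mul_left (Commute.refl s)
  have hmul := mul_idempotent_add_mul (x := t) (y := 1) he hes (Commute.one_right _)
  have hmul' := mul_idempotent_add_mul (x := s) (y := 1) he het (Commute.one_right _)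
  simp only [he.eq, one_mul, add_sub_cancel] at hmul
  simp only [h.1.eq, he.eq, one_mul, add_sub_cancel] at hmul'
  exact ⟨⟨_, _, hmul, hmul'⟩, rfl⟩

theorem isNilpotent_mul_one_sub (h : IsDrazinInverse t s) : IsNilpotent (t * (1 - t * s)) := by
  have he := h.isIdempotentElem_mul
  obtain ⟨hst, -, k, hk⟩ := h
  have hc : Commute t (1 - t * s) :=
    (Commute.one_right _).sub_right ((Commute.refl t).mul_right hst.symm)
  refine ⟨k + 1, ?_⟩
  rw [hc.mul_pow, he.one_sub.pow_succ_eq, mul_sub, mul_one, ← mul_assoc, ← pow_succ,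
    pow_succ_mul_eq_of_le hk k.le_succ, sub_self]

end Ring

theorem eventually_isUnit_sub {𝕜 A : Type*} [NontriviallyNormedField 𝕜] [NormedRing A]
    [NormedAlgebra 𝕜 A] [CompleteSpace A] {s t : A} (h : IsDrazinInverse t s) :
    ∀ᶠ z : 𝕜 in 𝓝[≠] 0, IsUnit (t - z • (1 : A)) := by
  have he := h.isIdempotentElem_mul
  have het : Commute (t * s) t := (Commute.refl t).mul_left h.1
  have hnil := h.isNilpotent_mul_one_sub
  have hcore : ∀ᶠ z : 𝕜 in 𝓝 0, IsUnit (t * (t * s) + (1 - t * s) - z • (1 : A)) := by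
    have hcont : Continuous fun z : 𝕜 => t * (t * s) + (1 - t * s) - z • (1 : A) := by fun_prop
    refine hcont.continuousAt.eventually_mem (Units.isOpen.mem_nhds (?_ : IsUnit _))
    rw [zero_smul, sub_zero]
    exact h.isUnit_core
  generalize t * s = e at he het hnil hcore
  filter_upwards [hcore.filter_mono nhdsWithin_le_nhds, self_mem_nhdsWithin] with z hz hz0
  have hz1 : ∀ a : A, Commute a (z • 1) := fun a => (Commute.one_right a).smul_right z
  have hnil_sub : IsUnit (t * (1 - e) - z • (1 : A)) := by
    have hz : IsUnit (-(z • (1 : A))) := ((isUnit_one.smul (Units.mk0 z hz0))).neg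
    rw [sub_eq_add_neg]
    exact hnil.isUnit_add_right_of_commute hz (hz1 _).neg_right
  have he1 : Commute e (1 - e) := (Commute.one_right e).sub_right (Commute.refl e)
  refine isUnit_of_mul_idempotent_eq he hz hnil_sub ?_ ?_ ?_ ?_
  · exact ((het.mul_right (Commute.refl e)).add_right he1).sub_right (hz1 e)
  · exact (het.mul_right he1).sub_right (hz1 e)
  · rw [sub_mul, sub_mul, add_mul, mul_assoc, he.eq, he.one_sub_mul_self, add_zero]
  · rw [sub_mul, sub_mul, mul_assoc, he.one_sub.eq]

end IsDrazinInverse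

section RieszProjection

open scoped Ring
open Complex (I exp)

theorem ringInverse_one_sub_add_ringInverse_one_add {R : Type*} [Ring R] {x : R}
    (hsub : IsUnit (1 - x)) (hadd : IsUnit (1 + x)) :
    (1 - x)⁻¹ʳ + (1 + x)⁻¹ʳ = 2 • ((1 - x)⁻¹ʳ * (1 + x)⁻¹ʳ) := by
  rw [Ring.inverse_add_inverse (iff_of_true hsub hadd), sub_add_add_cancel, one_add_one_eq_two,
    mul_assoc, two_mul, mul_add, two_nsmul]

theorem commute_ringInverse {M : Type*} [MonoidWithZero M] {x y : M} (h : Commute x y) :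
    Commute x y⁻¹ʳ := by
  by_cases hy : IsUnit y
  · obtain ⟨u, rfl⟩ := hy
    rw [Ring.inverse_unit]
    exact h.units_inv_right
  · rw [Ring.inverse_non_unit y hy]
    exact Commute.zero_right x

theorem isUnit_one_sub_smul_pow {A : Type*} [Ring A] [Algebra ℂ A] {a : A}
    (h : Disjoint (spectrum ℂ a) (Metric.sphere 0 1)) {n : ℕ} (hn : n ≠ 0) {z : ℂ}
    (hz : ‖z‖ = 1) : IsUnit (1 - z • a ^ n) := by
  have hz0 : z ≠ 0 := norm_ne_zero_iff.1 (hz ▸ one_ne_zero)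
  have hmem : z⁻¹ ∉ spectrum ℂ (a ^ n) := by
    rw [spectrum.map_pow_of_pos a hn.bot_lt]
    rintro ⟨w, hw, hwz⟩
    refine disjoint_left.1 h hw (mem_sphere_zero_iff_norm.2 ?_)
    rw [← pow_eq_one_iff_of_nonneg (norm_nonneg w) hn, ← norm_pow]
    simp only [hwz, norm_inv, hz, inv_one]
  rw [spectrum.notMem_iff, Algebra.algebraMap_eq_smul_one] at hmem
  convert hmem.smul (Units.mk0 z hz0) using 1
  rw [Units.smul_def, Units.val_mk0, smul_sub, smul_inv_smul₀ hz0]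

/-- The inverse of `1 - e ^ (iθ) a ^ (2 ^ k)`. When the spectrum of `a` avoids the unit circle,
these elements converge as `k → ∞` to the Riesz projection of `a` for the open unit disc. -/
noncomputable def dyadicResolvent {A : Type*} [Ring A] [Algebra ℂ A] (a : A) (k : ℕ) (θ : ℝ) : A :=
  (1 - exp (θ * I) • a ^ 2 ^ k)⁻¹ʳ

namespace dyadicResolvent

section Algebra

variable {A : Type*} [Ring A] [Algebra ℂ A] {a b : A}

theorem isUnit_one_sub (h : Disjoint (spectrum ℂ a) (Metric.sphere 0 1)) (k : ℕ) (θ : ℝ) :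
    IsUnit (1 - exp (θ * I) • a ^ 2 ^ k) :=
  isUnit_one_sub_smul_pow h (pow_ne_zero k two_ne_zero) (Complex.norm_exp_ofReal_mul_I θ)

theorem mul_one_sub_pow (h : Disjoint (spectrum ℂ a) (Metric.sphere 0 1)) (k : ℕ) :
    dyadicResolvent a k 0 * (1 - a ^ 2 ^ k) = 1 := by
  have := Ring.inverse_mul_cancel _ (isUnit_one_sub h k 0)
  simpa [dyadicResolvent] using this

theorem one_sub_pow_mul (h : Disjoint (spectrum ℂ a) (Metric.sphere 0 1)) (k : ℕ) :
    (1 - a ^ 2 ^ k) * dyadicResolvent a k 0 = 1 := by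
  have := Ring.mul_inverse_cancel _ (isUnit_one_sub h k 0)
  simpa [dyadicResolvent] using this

theorem commute (hb : Commute b a) (k : ℕ) (θ : ℝ) : Commute b (dyadicResolvent a k θ) :=
  commute_ringInverse ((Commute.one_right b).sub_right ((hb.pow_right _).smul_right _))

theorem eq_ringInverse_one_add (k : ℕ) (θ : ℝ) :
    dyadicResolvent a k (θ + Real.pi) = (1 + exp (θ * I) • a ^ 2 ^ k)⁻¹ʳ := by
  rw [dyadicResolvent, Complex.ofReal_add, add_mul, Complex.exp_add_pi_mul_I, neg_smul,
    sub_neg_eq_add]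

theorem mul_add_pi (h : Disjoint (spectrum ℂ a) (Metric.sphere 0 1)) (k : ℕ) (θ : ℝ) :
    dyadicResolvent a k (θ / 2) * dyadicResolvent a k (θ / 2 + Real.pi) =
      dyadicResolvent a (k + 1) θ := by
  have hsq : exp (θ * I) • a ^ 2 ^ (k + 1) = (exp ((θ / 2 : ℝ) * I) • a ^ 2 ^ k) ^ 2 := by
    rw [smul_pow, ← pow_mul, ← pow_succ, ← Complex.exp_nat_mul]
    congr 2
    push_cast
    ring
  rw [eq_ringInverse_one_add, dyadicResolvent, dyadicResolvent, hsq,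
    ← Ring.inverse_mul (Or.inr (isUnit_one_sub h k _)), ← (Commute.one_left _).sq_sub_sq, one_pow]

theorem add_add_pi (h : Disjoint (spectrum ℂ a) (Metric.sphere 0 1)) (k : ℕ) (θ : ℝ) :
    dyadicResolvent a k (θ / 2) + dyadicResolvent a k (θ / 2 + Real.pi) =
      2 • dyadicResolvent a (k + 1) θ := by
  have hadd := isUnit_one_sub h k (θ / 2 + Real.pi)
  rw [Complex.ofReal_add, add_mul, Complex.exp_add_pi_mul_I, neg_smul, sub_neg_eq_add] at hadd
  rw [← mul_add_pi h, eq_ringInverse_one_add]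
  exact ringInverse_one_sub_add_ringInverse_one_add (isUnit_one_sub h k _) hadd

end Algebra

section Analysis

variable {A : Type*} [NormedRing A] [NormedAlgebra ℂ A] {a b p : A}

theorem commute_of_tendsto (hp : Tendsto (fun k => dyadicResolvent a k 0) atTop (𝓝 p))
    (hb : Commute b a) : Commute b p :=
  tendsto_nhds_unique (hp.const_mul b) ((hp.mul_const b).congr fun k => (commute hb k 0).eq.symm)

/- Passing from `k` to `k + 1` averages over the two square roots of `e ^ (iθ)`, whose arguments
vary half as fast as `θ`. -/
theorem lipschitzWith {L : NNReal} (h : Disjoint (spectrum ℂ a) (Metric.sphere 0 1))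
    (hL : LipschitzWith L (dyadicResolvent a 0)) (k : ℕ) :
    LipschitzWith (L / 2 ^ k) (dyadicResolvent a k) := by
  induction k with
  | zero => simpa only [pow_zero, div_one] using hL
  | succ k ih =>
    refine .of_dist_le_mul fun θ φ => ?_
    have hhalf := ih.dist_le_mul (θ / 2) (φ / 2)
    have hhalf_pi := ih.dist_le_mul (θ / 2 + Real.pi) (φ / 2 + Real.pi)
    have hdist : dist (θ / 2) (φ / 2) = dist θ φ / 2 := by
      rw [Real.dist_eq, Real.dist_eq, ← sub_div, abs_div, abs_two]
    have htwo : 2 * dist (dyadicResolvent a (k + 1) θ) (dyadicResolvent a (k + 1) φ) =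
        dist (2 • dyadicResolvent a (k + 1) θ) (2 • dyadicResolvent a (k + 1) φ) := by
      rw [dist_eq_norm, dist_eq_norm, ← nsmul_sub, RCLike.norm_nsmul ℂ, two_nsmul, two_mul]
    rw [dist_add_right, hdist] at hhalf_pi
    rw [hdist] at hhalf
    rw [← add_add_pi h, ← add_add_pi h] at htwo
    have hadd := dist_add_add_le (dyadicResolvent a k (θ / 2))
      (dyadicResolvent a k (θ / 2 + Real.pi)) (dyadicResolvent a k (φ / 2))
      (dyadicResolvent a k (φ / 2 + Real.pi))
    push_cast at hhalf hhalf_pi ⊢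
    rw [pow_succ, ← div_div, div_mul_eq_mul_div, mul_div_assoc]
    linarith

variable [CompleteSpace A]

theorem continuous (h : Disjoint (spectrum ℂ a) (Metric.sphere 0 1)) (k : ℕ) :
    Continuous (dyadicResolvent a k) := by
  refine continuous_iff_continuousAt.2 fun θ => ?_
  obtain ⟨u, hu⟩ := isUnit_one_sub h k θ
  have hinv : ContinuousAt Ring.inverse (1 - exp (θ * I) • a ^ 2 ^ k) :=
    hu ▸ NormedRing.inverse_continuousAt u
  exact ContinuousAt.comp (f := fun θ : ℝ => 1 - exp (θ * I) • a ^ 2 ^ k) hinv (by fun_prop)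

theorem exists_norm_le (h : Disjoint (spectrum ℂ a) (Metric.sphere 0 1)) (k : ℕ) :
    ∃ C, ∀ θ, ‖dyadicResolvent a k θ‖ ≤ C := by
  have hper : Function.Periodic (dyadicResolvent a k) (2 * Real.pi) := fun θ => by
    simp only [dyadicResolvent, Complex.ofReal_add, Complex.ofReal_mul, Complex.ofReal_ofNat,
      add_mul, Complex.exp_add, Complex.exp_two_pi_mul_I, mul_one]
  obtain ⟨C, hC⟩ := (hper.compact_of_continuous Real.two_pi_pos.ne'
    (continuous h k)).isBounded.exists_norm_le
  exact ⟨C, fun θ => hC _ (mem_range_self θ)⟩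

theorem exists_lipschitzWith (h : Disjoint (spectrum ℂ a) (Metric.sphere 0 1)) :
    ∃ L : NNReal, LipschitzWith L (dyadicResolvent a 0) := by
  obtain ⟨C, hC⟩ := exists_norm_le h 0
  have hC0 : 0 ≤ C := (norm_nonneg _).trans (hC 0)
  have hexp (θ φ : ℝ) : ‖exp (θ * I) - exp (φ * I)‖ ≤ |θ - φ| := by
    have heq : exp (θ * I) - exp (φ * I) = exp (φ * I) * (exp (I * (θ - φ : ℝ)) - 1) := by
      rw [mul_sub, ← Complex.exp_add, mul_one]
      push_cast
      ring_nf
    rw [heq, norm_mul, Complex.norm_exp_ofReal_mul_I, one_mul]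
    exact Real.norm_exp_I_mul_ofReal_sub_one_le
  refine ⟨(C * ‖a‖ * C).toNNReal, .of_dist_le_mul fun θ φ => ?_⟩
  rw [Real.coe_toNNReal _ (by positivity), dist_eq_norm, Real.dist_eq]
  calc ‖dyadicResolvent a 0 θ - dyadicResolvent a 0 φ‖
      = ‖dyadicResolvent a 0 θ * ((exp (θ * I) - exp (φ * I)) • a) * dyadicResolvent a 0 φ‖ := by
        rw [dyadicResolvent, dyadicResolvent, Ring.inverse_sub_inverse
          (iff_of_true (isUnit_one_sub h 0 θ) (isUnit_one_sub h 0 φ)), sub_sub_sub_cancel_left,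
          ← sub_smul, pow_zero, pow_one]
    _ ≤ ‖dyadicResolvent a 0 θ‖ * (‖exp (θ * I) - exp (φ * I)‖ * ‖a‖) *
          ‖dyadicResolvent a 0 φ‖ := by
        rw [← norm_smul]
        exact norm_mul₃_le
    _ ≤ C * (|θ - φ| * ‖a‖) * C := by gcongr <;> first | exact hC _ | exact hexp _ _
    _ = C * ‖a‖ * C * |θ - φ| := by ring

theorem exists_dist_pi_le (h : Disjoint (spectrum ℂ a) (Metric.sphere 0 1)) :
    ∃ C : ℝ, ∀ k, dist (dyadicResolvent a k 0) (dyadicResolvent a k Real.pi) ≤ C / 2 ^ k := by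
  obtain ⟨L, hL⟩ := exists_lipschitzWith h
  refine ⟨L * Real.pi, fun k => ((lipschitzWith h hL k).dist_le_mul 0 Real.pi).trans_eq ?_⟩
  rw [dist_zero_left, Real.norm_of_nonneg Real.pi_pos.le, NNReal.coe_div, NNReal.coe_pow,
    NNReal.coe_ofNat, div_mul_eq_mul_div]

theorem cauchySeq (h : Disjoint (spectrum ℂ a) (Metric.sphere 0 1)) :
    CauchySeq fun k => dyadicResolvent a k 0 := by
  obtain ⟨C, hC⟩ := exists_dist_pi_le h
  refine cauchySeq_of_le_geometric_two (C := C) fun k => ?_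
  have hstep := add_add_pi h k 0
  rw [zero_div, zero_add] at hstep
  have heq : 2 • (dyadicResolvent a k 0 - dyadicResolvent a (k + 1) 0) =
      dyadicResolvent a k 0 - dyadicResolvent a k Real.pi := by
    rw [nsmul_sub, ← hstep, two_nsmul, add_sub_add_left_eq_sub]
  have hnorm := congrArg norm heq
  rw [RCLike.norm_nsmul ℂ, ← dist_eq_norm, ← dist_eq_norm, two_nsmul] at hnorm
  rw [div_right_comm]
  linarith [hC k]

theorem isIdempotentElem_of_tendsto (h : Disjoint (spectrum ℂ a) (Metric.sphere 0 1))
    (hp : Tendsto (fun k => dyadicResolvent a k 0) atTop (𝓝 p)) : IsIdempotentElem p := by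
  obtain ⟨C, hC⟩ := exists_dist_pi_le h
  have hdist : Tendsto (fun k => dist (dyadicResolvent a k 0) (dyadicResolvent a k Real.pi))
      atTop (𝓝 0) :=
    squeeze_zero (fun _ => dist_nonneg) hC
      (tendsto_const_nhds.div_atTop (tendsto_pow_atTop_atTop_of_one_lt one_lt_two))
  have hp_pi := (tendsto_iff_of_dist hdist).1 hp
  refine tendsto_nhds_unique (hp.mul hp_pi) ((hp.comp (tendsto_add_atTop_nat 1)).congr fun k => ?_)
  simpa only [zero_div, zero_add, Function.comp_apply] using (mul_add_pi h k 0).symm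

theorem tendsto_pow_mul (h : Disjoint (spectrum ℂ a) (Metric.sphere 0 1))
    (hp : Tendsto (fun k => dyadicResolvent a k 0) atTop (𝓝 p)) :
    Tendsto (fun k => a ^ 2 ^ k * p) atTop (𝓝 0) := by
  have hpp := isIdempotentElem_of_tendsto h hp
  have hpa : Commute p a := (commute_of_tendsto hp (Commute.refl a)).symm
  have hpE (k : ℕ) : Commute p (dyadicResolvent a k 0) := commute hpa k 0
  have hpa_pow (k : ℕ) : Commute p (1 - a ^ 2 ^ k) :=
    (Commute.one_right p).sub_right (hpa.pow_right _)
  have hinv (k : ℕ) : (dyadicResolvent a k 0 * p + 1 * (1 - p))⁻¹ʳ =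
      (1 - a ^ 2 ^ k) * p + 1 * (1 - p) := by
    refine Ring.inverse_unit ⟨_, _, ?_, ?_⟩
    · rw [mul_idempotent_add_mul hpp (hpa_pow k) (Commute.one_right p), mul_one_sub_pow h,
        one_mul, one_mul, one_mul, add_sub_cancel]
    · rw [mul_idempotent_add_mul hpp (hpE k) (Commute.one_right p), one_sub_pow_mul h,
        one_mul, one_mul, one_mul, add_sub_cancel]
  have hlim : Tendsto (fun k => dyadicResolvent a k 0 * p + 1 * (1 - p)) atTop (𝓝 1) := by
    have := (hp.mul_const p).add_const (1 * (1 - p))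
    simpa only [hpp.eq, one_mul, add_sub_cancel] using this
  have hlim_inv := (NormedRing.inverse_continuousAt (1 : Aˣ)).tendsto.comp hlim
  rw [Units.val_one, Ring.inverse_one] at hlim_inv
  have hsub := hlim_inv.const_sub 1
  rw [sub_self] at hsub
  refine hsub.congr fun k => ?_
  rw [Function.comp_apply, hinv]
  noncomm_ring

theorem isUnit_mul_one_sub_add (h : Disjoint (spectrum ℂ a) (Metric.sphere 0 1))
    (hp : Tendsto (fun k => dyadicResolvent a k 0) atTop (𝓝 p)) : IsUnit (a * (1 - p) + p) := by
  have hpp := isIdempotentElem_of_tendsto h hp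
  have hpa : Commute p a := (commute_of_tendsto hp (Commute.refl a)).symm
  have hlim : Tendsto (fun k => 1 - dyadicResolvent a k 0 * (1 - p)) atTop (𝓝 1) := by
    have := (hp.mul_const (1 - p)).const_sub 1
    rwa [hpp.mul_one_sub_self, sub_zero] at this
  obtain ⟨k, hk⟩ := (hlim.eventually (Units.isOpen.mem_nhds isUnit_one)).exists
  have hpE := commute hpa k 0
  have hone := one_sub_pow_mul h k
  set E := dyadicResolvent a k 0
  set b := -(a ^ (2 ^ k - 1) * E)
  have hab_eq : a * b = 1 - E := by
    rw [mul_neg, ← mul_assoc, mul_pow_sub_one (pow_ne_zero k two_ne_zero), neg_eq_iff_eq_neg,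
      neg_sub, ← hone, sub_mul, one_mul, sub_sub_cancel]
  have hab : Commute a b :=
    ((Commute.self_pow a _).mul_right (commute (Commute.refl a) k 0)).neg_right
  have hpb : Commute p b := ((hpa.pow_right _).mul_right hpE).neg_right
  have hmul := mul_idempotent_add_mul (x := a) (y := 1) hpp.one_sub
    ((Commute.one_left b).sub_left hpb) (Commute.one_right _)
  have hmul' := mul_idempotent_add_mul (x := b) (y := 1) hpp.one_sub
    ((Commute.one_left a).sub_left hpa) (Commute.one_right _)
  have hunit : IsUnit (a * b * (1 - p) + 1 * 1 * (1 - (1 - p))) := by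
    convert hk using 1
    rw [hab_eq]
    noncomm_ring
  have hcomm := hmul.trans (hab.eq ▸ hmul'.symm)
  rw [← hmul, Commute.isUnit_mul_iff hcomm] at hunit
  simpa only [one_mul, sub_sub_cancel] using hunit.1

end Analysis

end dyadicResolvent

theorem norm_lt_one_of_mem_spectrum_of_tendsto_pow {𝕜 A ι : Type*} [NormedField 𝕜] [NormedRing A]
    [NormedAlgebra 𝕜 A] [CompleteSpace A] {a : A} {l : Filter ι} [l.NeBot] {n : ι → ℕ}
    (h : Tendsto (fun i => a ^ n i) l (𝓝 0)) {z : 𝕜} (hz : z ∈ spectrum 𝕜 a) : ‖z‖ < 1 := by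
  have hnorm := h.norm.mul_const ‖(1 : A)‖
  rw [norm_zero, zero_mul] at hnorm
  obtain ⟨i, hi⟩ := (hnorm.eventually (gt_mem_nhds one_pos)).exists
  have hpow := (spectrum.norm_le_norm_mul_of_mem (spectrum.pow_mem_pow a (n i) hz)).trans_lt hi
  rw [norm_pow] at hpow
  exact lt_of_not_ge fun hge => (one_le_pow₀ hge).not_gt hpow

theorem exists_riesz_idempotent_of_disjoint_unit_sphere {A : Type*} [NormedRing A]
    [NormedAlgebra ℂ A] [CompleteSpace A] {a : A}
    (h : Disjoint (spectrum ℂ a) (Metric.sphere 0 1)) :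
    ∃ p : A, IsIdempotentElem p ∧ Commute p a ∧ IsUnit (a * (1 - p) + p) ∧
      spectrum ℂ (a * p) ⊆ Metric.ball 0 1 := by
  obtain ⟨p, hp⟩ := cauchySeq_tendsto_of_complete (dyadicResolvent.cauchySeq h)
  have hpp := dyadicResolvent.isIdempotentElem_of_tendsto h hp
  have hpa := (dyadicResolvent.commute_of_tendsto hp (Commute.refl a)).symm
  refine ⟨p, hpp, hpa, dyadicResolvent.isUnit_mul_one_sub_add h hp, fun z hz => ?_⟩
  have hpow := (dyadicResolvent.tendsto_pow_mul h hp).congr fun k => by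
    rw [← hpp.pow_eq (pow_ne_zero k two_ne_zero), ← hpa.symm.mul_pow]
  exact mem_ball_zero_iff.2 (norm_lt_one_of_mem_spectrum_of_tendsto_pow hpow hz)

theorem exists_riesz_idempotent {A : Type*} [NormedRing A] [NormedAlgebra ℂ A] [CompleteSpace A]
    {a : A} {r : ℝ} (hr : 0 < r) (h : Disjoint (spectrum ℂ a) (Metric.sphere 0 r)) :
    ∃ p : A, IsIdempotentElem p ∧ Commute p a ∧ IsUnit (a * (1 - p) + p) ∧
      spectrum ℂ (a * p) ⊆ Metric.ball 0 r := by
  set c : ℂˣ := Units.mk0 (r : ℂ) (Complex.ofReal_ne_zero.2 hr.ne')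
  have hc : ‖(c : ℂ)‖ = r := by rw [Units.val_mk0, Complex.norm_real, Real.norm_of_nonneg hr.le]
  obtain ⟨b, rfl⟩ : ∃ b, a = c • b := ⟨c⁻¹ • a, (smul_inv_smul c a).symm⟩
  have hb : Disjoint (spectrum ℂ b) (Metric.sphere 0 1) := by
    refine disjoint_left.2 fun z hz hz1 => disjoint_left.1 h (spectrum.smul_mem_smul_iff.2 hz) ?_
    rw [mem_sphere_zero_iff_norm] at hz1 ⊢
    rw [Units.smul_def, norm_smul, hc, hz1, mul_one]
  obtain ⟨p, hpp, hpb, hunit, hball⟩ := exists_riesz_idempotent_of_disjoint_unit_sphere hb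
  refine ⟨p, hpp, hpb.smul_right c, ?_, ?_⟩
  · have hq : Commute (1 - p) (b * (1 - p) + p) :=
      (((Commute.one_left b).sub_left hpb).mul_right (Commute.refl _)).add_right
        ((Commute.one_left p).sub_left (Commute.refl p))
    refine isUnit_of_mul_idempotent_eq hpp.one_sub (hunit.smul c) isUnit_one (hq.smul_right c)
      (Commute.one_right _) ?_ ?_
    · simp only [add_mul, smul_mul_assoc, mul_assoc, hpp.one_sub.eq, hpp.mul_one_sub_self, add_zero]
    · simp only [sub_sub_cancel, add_mul, mul_assoc, hpp.one_sub_mul_self, hpp.eq, mul_zero,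
        zero_add, one_mul]
  · rw [smul_mul_assoc, spectrum.unit_smul_eq_smul]
    rintro _ ⟨z, hz, rfl⟩
    have := mem_ball_zero_iff.1 (hball hz)
    rw [mem_ball_zero_iff]
    change ‖(c : ℂ) • z‖ < r
    rw [norm_smul, hc]
    exact mul_lt_of_lt_one_right hr this

end RieszProjection

section Retract

section Topological

variable {R X Y : Type*} [Semiring R] [AddCommMonoid X] [Module R X] [TopologicalSpace X]
  [AddCommMonoid Y] [Module R Y] [TopologicalSpace Y] {u s : X →L[R] X} {v : Y →L[R] Y}
  {i : Y →L[R] X} {p : X →L[R] Y}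

theorem isUnit_of_retract (hpi : Function.LeftInverse p i) (hi : Function.Semiconj i v u)
    (hp : Function.Semiconj p u v) (hu : IsUnit u) : IsUnit v := by
  obtain ⟨w, rfl⟩ := hu
  have hw (x : X) : (w : X →L[R] X) ((↑w⁻¹ : X →L[R] X) x) = x := DFunLike.congr_fun w.mul_inv x
  have hw' (x : X) : (↑w⁻¹ : X →L[R] X) ((w : X →L[R] X) x) = x := DFunLike.congr_fun w.inv_mul x
  refine ⟨⟨v, p ∘L (↑w⁻¹ : X →L[R] X) ∘L i, ContinuousLinearMap.ext fun y => ?_,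
    ContinuousLinearMap.ext fun y => ?_⟩, rfl⟩
  · exact (hp _).symm.trans ((congrArg p (hw (i y))).trans (hpi y))
  · exact (congrArg (p ∘ (↑w⁻¹ : X →L[R] X)) (hi y)).trans
      ((congrArg p (hw' (i y))).trans (hpi y))

theorem IsDrazinInverse.of_retract (hpi : Function.LeftInverse p i) (hi : Function.Semiconj i v u)
    (hp : Function.Semiconj p u v) (h : IsDrazinInverse u s) :
    IsDrazinInverse v (p ∘L s ∘L i) := by
  have hip : Commute (i ∘L p) u :=
    ContinuousLinearMap.ext fun x => (congrArg i (hp x)).trans (hi (p x))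
  have hips (x : X) : i (p (s x)) = s (i (p x)) := DFunLike.congr_fun (h.commute hip).eq x
  obtain ⟨hsu, hs, k, hk⟩ := h
  have hsu (x : X) : s (u x) = u (s x) := DFunLike.congr_fun hsu.eq x
  have hs (x : X) : s (u (s x)) = s x := DFunLike.congr_fun hs x
  have hk (x : X) : (u ^ (k + 1)) (s x) = (u ^ k) x := DFunLike.congr_fun hk x
  have hp_pow (n : ℕ) : Function.Semiconj p ⇑(u ^ n) ⇑(v ^ n) := by
    simpa only [FunLike.coe_pow_eq_iterate] using hp.iterate_right n
  refine ⟨?_, ?_, k, ?_⟩ <;> ext y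
  · change p (s (i (v y))) = v (p (s (i y)))
    rw [hi.eq, hsu, hp.eq]
  · change p (s (i (v (p (s (i y)))))) = p (s (i y))
    rw [hi.eq, hips, hpi, hs]
  · change (v ^ (k + 1)) (p (s (i y))) = (v ^ k) y
    rw [← (hp_pow _).eq, hk, (hp_pow _).eq, hpi]

end Topological

open scoped LinearMap.FiniteRangeSetoid in
theorem isFredholm_of_retract {𝕜 X Y : Type*} [NontriviallyNormedField 𝕜] [CompleteSpace 𝕜]
    [AddCommGroup X] [Module 𝕜 X] [TopologicalSpace X] [IsTopologicalAddGroup X]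
    [ContinuousSMul 𝕜 X] [T2Space X] [AddCommGroup Y] [Module 𝕜 Y] [TopologicalSpace Y]
    [IsTopologicalAddGroup Y] [ContinuousSMul 𝕜 Y] [T2Space Y] {u : X →L[𝕜] X} {v : Y →L[𝕜] Y}
    {i : Y →L[𝕜] X} {p : X →L[𝕜] Y} (hpi : Function.LeftInverse p i)
    (hi : Function.Semiconj i v u) (hp : Function.Semiconj p u v) (hu : u.IsFredholm) :
    v.IsFredholm := by
  obtain ⟨w, hwu, huw⟩ := hu.exists_isQuasiInverse
  have hid : p.toLinearMap ∘ₗ LinearMap.id ∘ₗ i.toLinearMap = LinearMap.id :=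
    LinearMap.ext hpi
  have hconj {f : X →ₗ[𝕜] X} (hf : f ≈ LinearMap.id) :
      p.toLinearMap ∘ₗ f ∘ₗ i.toLinearMap ≈ LinearMap.id :=
    hid ▸ LinearMap.FiniteRangeSetoid.equiv_comp_left
      (LinearMap.FiniteRangeSetoid.equiv_comp_right hf)
  refine .of_isQuasiInverse (v := p ∘L w ∘L i) ⟨?_, ?_⟩
  · have heq : (p ∘L w ∘L i).toLinearMap ∘ₗ v.toLinearMap =
        p.toLinearMap ∘ₗ (w.toLinearMap ∘ₗ u.toLinearMap) ∘ₗ i.toLinearMap :=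
      LinearMap.ext fun y => congrArg (p ∘ w) (hi y)
    rw [LinearMap.IsLeftQuasiInverse, heq]
    exact hconj hwu
  · have heq : v.toLinearMap ∘ₗ (p ∘L w ∘L i).toLinearMap =
        p.toLinearMap ∘ₗ (u.toLinearMap ∘ₗ w.toLinearMap) ∘ₗ i.toLinearMap :=
      LinearMap.ext fun y => (hp (w (i y))).symm
    rw [LinearMap.IsRightQuasiInverse, heq]
    exact hconj huw

end Retract

section BlockDiagonal

variable {R X : Type*} [Ring R] [AddCommGroup X] [Module R X] [TopologicalSpace X]
  [IsTopologicalAddGroup X] {M N : Submodule R X}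

/-- The direct sum of two operators along a topological direct sum decomposition `X = M ⊕ N`,
bundled as a monoid homomorphism in the pair of operators. -/
noncomputable def blockDiag (h : Submodule.IsTopCompl M N) :
    (M →L[R] M) × (N →L[R] N) →* (X →L[R] X) where
  toFun A := M.subtypeL ∘L A.1 ∘L M.projectionOntoL N h +
    N.subtypeL ∘L A.2 ∘L N.projectionOntoL M h.symm
  map_one' := Submodule.projectionL_add_projectionL_eq_id h
  map_mul' A B := by
    ext x
    simp

theorem blockDiag_apply (h : Submodule.IsTopCompl M N) (A : (M →L[R] M) × (N →L[R] N)) (x : X) :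
    blockDiag h A x = A.1 (M.projectionOntoL N h x) + A.2 (N.projectionOntoL M h.symm x) := rfl

theorem blockDiag_restrict (h : Submodule.IsTopCompl M N) (T : X →L[R] X)
    (hM : ∀ x ∈ M, T x ∈ M) (hN : ∀ x ∈ N, T x ∈ N) :
    blockDiag h (T.restrict hM, T.restrict hN) = T := by
  ext x
  rw [blockDiag_apply, ContinuousLinearMap.coe_restrict_apply,
    ContinuousLinearMap.coe_restrict_apply, ← map_add]
  exact congrArg T (DFunLike.congr_fun (map_one (blockDiag h)) x)

theorem isUnit_of_restrict (h : Submodule.IsTopCompl M N) {T : X →L[R] X}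
    {hM : ∀ x ∈ M, T x ∈ M} {hN : ∀ x ∈ N, T x ∈ N} (hTM : IsUnit (T.restrict hM))
    (hTN : IsUnit (T.restrict hN)) : IsUnit T :=
  blockDiag_restrict h T hM hN ▸ (Prod.isUnit_iff.2 ⟨hTM, hTN⟩).map (blockDiag h)

theorem exists_isDrazinInverse_of_restrict (h : Submodule.IsTopCompl M N) {T : X →L[R] X}
    {hM : ∀ x ∈ M, T x ∈ M} {hN : ∀ x ∈ N, T x ∈ N}
    (hTM : ∃ A, IsDrazinInverse (T.restrict hM) A) (hTN : ∃ B, IsDrazinInverse (T.restrict hN) B) :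
    ∃ S, IsDrazinInverse T S := by
  obtain ⟨A, hA⟩ := hTM
  obtain ⟨B, hB⟩ := hTN
  exact ⟨_, blockDiag_restrict h T hM hN ▸ (hA.prodMk hB).map (blockDiag h)⟩

theorem projectionOntoL_add_projectionOntoL_eq_self (h : Submodule.IsTopCompl M N) (x : X) :
    (M.projectionOntoL N h x : X) + N.projectionOntoL M h.symm x = x :=
  Submodule.projectionL_add_projectionL_eq_self h x

theorem semiconj_projectionOntoL (h : Submodule.IsTopCompl M N) {T : X →L[R] X}
    (hM : ∀ x ∈ M, T x ∈ M) (hN : ∀ x ∈ N, T x ∈ N) :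
    Function.Semiconj (M.projectionOntoL N h) T (T.restrict hM) := fun x => by
  conv_lhs => rw [← projectionOntoL_add_projectionOntoL_eq_self h x, map_add, map_add]
  rw [Submodule.projectionOntoL_apply_eq_zero_of_mem_right h
    (hN _ (N.projectionOntoL M h.symm x).2), add_zero]
  exact Submodule.projectionOntoL_apply_left h (T.restrict hM _)

end BlockDiagonal

open scoped LinearMap.FiniteRangeSetoid in
theorem isFredholm_of_restrict {𝕜 X : Type*} [NontriviallyNormedField 𝕜] [CompleteSpace 𝕜]
    [AddCommGroup X] [Module 𝕜 X] [TopologicalSpace X] [IsTopologicalAddGroup X]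
    [ContinuousSMul 𝕜 X] [T2Space X] {M N : Submodule 𝕜 X} (h : Submodule.IsTopCompl M N)
    {T : X →L[𝕜] X} {hM : ∀ x ∈ M, T x ∈ M} {hN : ∀ x ∈ N, T x ∈ N}
    (hTM : IsUnit (T.restrict hM)) (hTN : (T.restrict hN).IsFredholm) : T.IsFredholm := by
  obtain ⟨u, hu⟩ := hTM
  obtain ⟨w, hwT, hTw⟩ := hTN.exists_isQuasiInverse
  have hone {C : N →L[𝕜] N} (hC : C.toLinearMap ≈ LinearMap.id) :
      (blockDiag h (1, C)).toLinearMap ≈ LinearMap.id := by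
    rw [LinearMap.FiniteRangeSetoid.equiv_iff_hasFiniteRange] at hC ⊢
    have heq : (blockDiag h (1, C)).toLinearMap - LinearMap.id =
        (N.subtype ∘ₗ (C.toLinearMap - LinearMap.id)) ∘ₗ
          (N.projectionOntoL M h.symm).toLinearMap := by
      ext x
      change (M.projectionOntoL N h x : X) + C (N.projectionOntoL M h.symm x) - x =
        C (N.projectionOntoL M h.symm x) - (N.projectionOntoL M h.symm x : X)
      nth_rw 3 [← projectionOntoL_add_projectionOntoL_eq_self h x]
      abel
    rw [heq]
    exact (hC.comp_left N.subtype).comp_right (N.projectionOntoL M h.symm).toLinearMap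
  rw [← blockDiag_restrict h T hM hN, ← hu]
  refine .of_isQuasiInverse (v := blockDiag h (↑u⁻¹, w)) ⟨?_, ?_⟩
  · change (blockDiag h (↑u⁻¹, w) * blockDiag h (↑u, T.restrict hN)).toLinearMap ≈ LinearMap.id
    rw [← map_mul, Prod.mk_mul_mk, Units.inv_mul]
    exact hone hwT
  · change (blockDiag h (↑u, T.restrict hN) * blockDiag h (↑u⁻¹, w)).toLinearMap ≈ LinearMap.id
    rw [← map_mul, Prod.mk_mul_mk, Units.mul_inv]
    exact hone hTw

section AscentDescent

theorem range_pow_constant {R V : Type*} [Semiring R] [AddCommMonoid V] [Module R V]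
    {f : Module.End R V} {k : ℕ} (h : (f ^ k).range = (f ^ (k + 1)).range) (m : ℕ) :
    (f ^ k).range = (f ^ (k + m)).range := by
  induction m with
  | zero => rfl
  | succ m ih =>
    rw [ih, add_left_comm, add_comm k m, pow_add f m k, pow_add f m (k + 1)]
    simp only [Module.End.mul_eq_comp, LinearMap.range_comp, h]

theorem isCompl_range_ker {R V : Type*} [Ring R] [AddCommGroup V] [Module R V]
    {f : Module.End R V} (hker : f.ker = (f * f).ker) (hrange : f.range = (f * f).range) :
    IsCompl f.range f.ker := by
  refine ⟨Submodule.disjoint_def.2 ?_, codisjoint_iff.2 (eq_top_iff.2 fun x _ => ?_)⟩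
  · rintro _ ⟨x, rfl⟩ hx
    exact LinearMap.mem_ker.1 (hker ▸ hx : x ∈ f.ker)
  · obtain ⟨y, hy⟩ : f x ∈ (f * f).range := hrange ▸ ⟨x, rfl⟩
    refine Submodule.mem_sup.2 ⟨f y, ⟨y, rfl⟩, x - f y, ?_, add_sub_cancel _ _⟩
    rw [LinearMap.mem_ker, map_sub, sub_eq_zero]
    exact hy.symm

theorem isClosed_range_of_isCompl {𝕜 E F : Type*} [NontriviallyNormedField 𝕜]
    [NormedAddCommGroup E] [NormedSpace 𝕜 E] [CompleteSpace E] [NormedAddCommGroup F]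
    [NormedSpace 𝕜 F] [CompleteSpace F] {f : E →L[𝕜] F} {G : Submodule 𝕜 F}
    (h : IsCompl f.range G) (hG : IsClosed (G : Set F)) : IsClosed (f.range : Set F) := by
  have := hG.completeSpace_coe
  have hsurj : Function.Surjective (f.coprod G.subtypeL) :=
    LinearMap.range_eq_top.1 (by simp [LinearMap.range_coprod, h.sup_eq_top])
  -- By the open mapping theorem it suffices that the preimage of the range of `f` is `E × {0}`.
  have hpre : f.coprod G.subtypeL ⁻¹' f.range = Set.univ ×ˢ {0} := by
    ext ⟨x, g⟩
    have hg : f x + g ∈ f.range ↔ (g : F) ∈ f.range := Submodule.add_mem_iff_right _ ⟨x, rfl⟩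
    have hg0 : (g : F) ∈ f.range ↔ g = 0 :=
      ⟨fun hg => Subtype.ext (Submodule.disjoint_def.1 h.disjoint _ hg g.2),
        fun hg => hg ▸ zero_mem _⟩
    simpa using hg.trans hg0
  rw [← (ContinuousLinearMap.isQuotientMap _ hsurj).isClosed_preimage, hpre]
  exact isClosed_univ.prod isClosed_singleton

theorem apply_mem_ker_of_commute {R X : Type*} [Semiring R] [AddCommMonoid X] [Module R X]
    [TopologicalSpace X] {f g : X →L[R] X} (h : Commute f g) : ∀ x ∈ f.ker, g x ∈ f.ker :=
  fun x (hx : f x = 0) =>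
    show f (g x) = 0 by rw [← mul_apply_eq_comp, h.eq, mul_apply_eq_comp, hx, map_zero]

theorem apply_mem_range_of_commute {R X : Type*} [Semiring R] [AddCommMonoid X] [Module R X]
    [TopologicalSpace X] {f g : X →L[R] X} (h : Commute f g) : ∀ x ∈ f.range, g x ∈ f.range := by
  rintro _ ⟨x, rfl⟩
  exact ⟨g x, DFunLike.congr_fun h.eq x⟩

variable {X : Type*} [NormedAddCommGroup X] [NormedSpace ℂ X] {T : X →L[ℂ] X}

theorem IsDrazinInvertible.hasFiniteAscent (hT : IsDrazinInvertible T) : HasFiniteAscent T := by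
  obtain ⟨s, hsT, -, k, hk⟩ := hT
  refine ⟨k, le_antisymm (fun x (hx : (T ^ k) x = 0) => ?_)
    fun x (hx : (T ^ (k + 1)) x = 0) => ?_⟩
  · change (T ^ (k + 1)) x = 0
    rw [pow_succ', mul_apply_eq_comp, hx, map_zero]
  · change (T ^ k) x = 0
    rw [← hk, ← (hsT.pow_right _).eq, mul_apply_eq_comp, hx, map_zero]

theorem IsDrazinInvertible.hasFiniteDescent (hT : IsDrazinInvertible T) : HasFiniteDescent T := by
  obtain ⟨s, -, -, k, hk⟩ := hT
  refine ⟨k, le_antisymm ?_ ?_⟩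
  · rintro _ ⟨x, rfl⟩
    exact ⟨s x, DFunLike.congr_fun hk x⟩
  · rintro _ ⟨x, rfl⟩
    exact ⟨T x, by rw [pow_succ]; rfl⟩

theorem exists_forall_le_ker_range_pow_eq (hA : HasFiniteAscent T) (hD : HasFiniteDescent T) :
    ∃ n, ∀ m ≥ n, (T ^ n).ker = (T ^ m).ker ∧ (T ^ n).range = (T ^ m).range := by
  obtain ⟨p, hp⟩ := hA
  obtain ⟨q, hq⟩ := hD
  simp only [ContinuousLinearMap.toLinearMap_pow] at hp hq ⊢
  have hker (m : ℕ) (hm : p ≤ m) : (T.toLinearMap ^ p).ker = (T.toLinearMap ^ m).ker :=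
    Nat.add_sub_cancel' hm ▸ Module.End.ker_pow_constant hp (m - p)
  have hrange (m : ℕ) (hm : q ≤ m) : (T.toLinearMap ^ q).range = (T.toLinearMap ^ m).range :=
    Nat.add_sub_cancel' hm ▸ range_pow_constant hq (m - q)
  refine ⟨max p q, fun m hm => ⟨?_, ?_⟩⟩
  · rw [← hker _ (le_max_left p q), hker m (by omega)]
  · rw [← hrange _ (le_max_right p q), hrange m (by omega)]

variable [CompleteSpace X]

theorem isTopCompl_range_ker (hker : T.ker = (T * T).ker) (hrange : T.range = (T * T).range) :
    Submodule.IsTopCompl T.range T.ker :=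
  have hcompl : IsCompl T.range T.ker := isCompl_range_ker hker hrange
  Submodule.isTopCompl_iff_isCompl_isClosed.2
    ⟨hcompl, isClosed_range_of_isCompl hcompl T.isClosed_ker, T.isClosed_ker⟩

theorem isUnit_restrict_range_pow {n : ℕ} (hT : ∀ x ∈ (T ^ n).range, T x ∈ (T ^ n).range)
    (hclosed : IsClosed ((T ^ n).range : Set X)) (hker : (T ^ n).ker = (T ^ (n + 1)).ker)
    (hrange : (T ^ n).range = (T ^ (n + 1)).range) : IsUnit (T.restrict hT) := by
  have := hclosed.completeSpace_coe
  rw [pow_succ'] at hker hrange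
  refine ContinuousLinearMap.isUnit_iff_bijective.2
    ⟨(injective_iff_map_eq_zero _).2 ?_, ?_⟩
  · rintro ⟨_, x, rfl⟩ hx
    exact Subtype.ext (hker ▸ congrArg Subtype.val hx : x ∈ (T ^ n).ker)
  · rintro ⟨_, x, rfl⟩
    obtain ⟨y, hy⟩ : (T ^ n) x ∈ (T * T ^ n).range := hrange ▸ ⟨x, rfl⟩
    exact ⟨⟨_, y, rfl⟩, Subtype.ext hy⟩

theorem HasFiniteAscent.isDrazinInvertible (hA : HasFiniteAscent T) (hD : HasFiniteDescent T) :
    IsDrazinInvertible T := by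
  obtain ⟨n, hn⟩ := exists_forall_le_ker_range_pow_eq hA hD
  have htop : Submodule.IsTopCompl (T ^ n).range (T ^ n).ker :=
    have h := hn (n + n) (by omega)
    isTopCompl_range_ker (pow_add T n n ▸ h.1) (pow_add T n n ▸ h.2)
  have hcomm : Commute (T ^ n) T := (Commute.refl T).pow_left n
  have hM := apply_mem_range_of_commute hcomm
  have hN := apply_mem_ker_of_commute hcomm
  have hnil : IsNilpotent (T.restrict hN : (T ^ n).ker →L[ℂ] (T ^ n).ker) := by
    refine ⟨n, ContinuousLinearMap.ext fun x => Subtype.ext ?_⟩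
    have hval : Function.Semiconj Subtype.val (T.restrict hN) T := fun _ => rfl
    rw [FunLike.coe_pow_eq_iterate, (hval.iterate_right n).eq, ← FunLike.coe_pow_eq_iterate]
    exact x.2
  obtain ⟨u, hu⟩ := isUnit_restrict_range_pow hM htop.isClosed (hn _ n.le_succ).1 (hn _ n.le_succ).2
  exact exists_isDrazinInverse_of_restrict htop (hM := hM) (hN := hN)
    ⟨_, hu ▸ IsDrazinInverse.units_inv u⟩
    ⟨0, IsDrazinInverse.zero_of_isNilpotent hnil⟩

theorem isBrowder_iff : IsBrowder T ↔ T.IsFredholm ∧ IsDrazinInvertible T :=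
  and_congr_right fun _ =>
    ⟨fun h => h.1.isDrazinInvertible h.2, fun h => ⟨h.hasFiniteAscent, h.hasFiniteDescent⟩⟩

end AscentDescent

section Spec

theorem isFredholm_of_isUnit {𝕜 X : Type*} [NontriviallyNormedField 𝕜] [CompleteSpace 𝕜]
    [AddCommGroup X] [Module 𝕜 X] [TopologicalSpace X] [IsTopologicalAddGroup X]
    [ContinuousSMul 𝕜 X] [T2Space X] {T : X →L[𝕜] X} (h : IsUnit T) : T.IsFredholm := by
  obtain ⟨u, rfl⟩ := h
  refine .of_isQuasiInverse (v := (↑u⁻¹ : X →L[𝕜] X)) ⟨?_, ?_⟩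
  · exact Quotient.exact (congrArg _ (congrArg ContinuousLinearMap.toLinearMap u.inv_mul))
  · exact Quotient.exact (congrArg _ (congrArg ContinuousLinearMap.toLinearMap u.mul_inv))

theorem notMem_spectrum_iff_isUnit_sub_smul_one {R A : Type*} [CommSemiring R] [Ring A]
    [Algebra R A] {a : A} {z : R} : z ∉ spectrum R a ↔ IsUnit (a - z • (1 : A)) := by
  rw [spectrum.notMem_iff, Algebra.algebraMap_eq_smul_one, ← IsUnit.neg_iff, neg_sub]

theorem sub_smul_one_mem {R X : Type*} [CommRing R] [AddCommGroup X] [Module R X]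
    [TopologicalSpace X] [IsTopologicalAddGroup X] [ContinuousConstSMul R X]
    {T : X →L[R] X} {N : Submodule R X} (hN : ∀ x ∈ N, T x ∈ N) (z : R) :
    ∀ x ∈ N, (T - z • (1 : X →L[R] X)) x ∈ N := fun x hx =>
  N.sub_mem (hN x hx) (N.smul_mem z hx)

variable {X : Type*} [NormedAddCommGroup X] [NormedSpace ℂ X] {κ : SpectrumKind} {T : X →L[ℂ] X}
  {z : ℂ}

/-- The kind of invertibility that defines the spectrum `σ_*`: `z ∈ σ_*(T)` if and only if `T - z`
is not invertible in this sense. -/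
def SpectrumKind.IsInvertible : SpectrumKind → (X →L[ℂ] X) → Prop
  | .ordinary, T => IsUnit T
  | .browder, T => IsBrowder T
  | .drazin, T => IsDrazinInvertible T

theorem SpectrumKind.notMem_spec :
    z ∉ κ.spec T ↔ κ.IsInvertible (T - z • (1 : X →L[ℂ] X)) := by
  cases κ with
  | ordinary => exact notMem_spectrum_iff_isUnit_sub_smul_one
  | browder => exact not_not
  | drazin => exact not_not

theorem SpectrumKind.spec_sub_smul_one (κ : SpectrumKind) (T : X →L[ℂ] X) (μ : ℂ) :
    κ.spec (T - μ • (1 : X →L[ℂ] X)) = Homeomorph.addRight μ ⁻¹' κ.spec T := by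
  ext z
  rw [← not_iff_not, mem_preimage, notMem_spec, notMem_spec, Homeomorph.coe_addRight, sub_sub,
    ← add_smul, add_comm]

theorem SpectrumKind.zero_mem_spec_sub_smul_one {μ : ℂ} :
    0 ∈ κ.spec (T - μ • (1 : X →L[ℂ] X)) ↔ μ ∈ κ.spec T := by
  rw [spec_sub_smul_one, mem_preimage, Homeomorph.coe_addRight]
  simp only [zero_add]

theorem IsDrazinInvertible.of_isUnit (h : IsUnit T) : IsDrazinInvertible T := by
  obtain ⟨u, rfl⟩ := h
  exact ⟨_, IsDrazinInverse.units_inv u⟩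

theorem SpectrumKind.IsInvertible.of_isUnit (h : IsUnit T) : κ.IsInvertible T := by
  have hd : IsDrazinInvertible T := .of_isUnit h
  cases κ with
  | ordinary => exact h
  | browder => exact ⟨isFredholm_of_isUnit h, hd.hasFiniteAscent, hd.hasFiniteDescent⟩
  | drazin => exact hd

theorem SpectrumKind.spec_subset_spectrum (κ : SpectrumKind) (T : X →L[ℂ] X) :
    κ.spec T ⊆ spectrum ℂ T := fun z hz => by
  by_contra h
  exact notMem_spec.2 (.of_isUnit (notMem_spectrum_iff_isUnit_sub_smul_one.1 h)) hz

variable [CompleteSpace X]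

theorem SpectrumKind.IsInvertible.isDrazinInvertible (h : κ.IsInvertible T) :
    IsDrazinInvertible T := by
  cases κ with
  | ordinary => exact .of_isUnit h
  | browder => exact (isBrowder_iff.1 h).2
  | drazin => exact h

theorem SpectrumKind.eventually_notMem_spectrum (h : z ∉ κ.spec T) :
    ∀ᶠ w in 𝓝[≠] z, w ∉ spectrum ℂ T := by
  obtain ⟨s, hs⟩ := (notMem_spec.1 h).isDrazinInvertible
  have hmap : map (· + z) (𝓝[≠] 0) = 𝓝[≠] z := by simp
  rw [← hmap, eventually_map]
  filter_upwards [IsDrazinInverse.eventually_isUnit_sub (𝕜 := ℂ) hs] with w hw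
  rwa [notMem_spectrum_iff_isUnit_sub_smul_one, add_comm, add_smul, ← sub_sub]

theorem SpectrumKind.isClosed_spec (κ : SpectrumKind) (T : X →L[ℂ] X) :
    IsClosed (κ.spec T) := by
  rw [← isOpen_compl_iff, isOpen_iff_eventually]
  intro z hz
  filter_upwards [eventually_nhdsWithin_iff.1 (eventually_notMem_spectrum hz)] with w hw
  obtain rfl | hwz := eq_or_ne w z
  · exact hz
  · exact fun hw' => hw hwz (κ.spec_subset_spectrum T hw')

variable {M N : Submodule ℂ X}

theorem SpectrumKind.IsInvertible.restrict (h : Submodule.IsTopCompl M N)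
    (hM : ∀ x ∈ M, T x ∈ M) (hN : ∀ x ∈ N, T x ∈ N) (hT : κ.IsInvertible T) :
    κ.IsInvertible (T.restrict hM) := by
  have := h.isClosed.completeSpace_coe
  have hpi : Function.LeftInverse (M.projectionOntoL N h) M.subtypeL :=
    Submodule.projectionOntoL_apply_left h
  have hi : Function.Semiconj M.subtypeL (T.restrict hM) T := fun _ => rfl
  have hp := semiconj_projectionOntoL h hM hN
  obtain ⟨s, hs⟩ := hT.isDrazinInvertible
  have hD : IsDrazinInvertible (T.restrict hM) := ⟨_, IsDrazinInverse.of_retract hpi hi hp hs⟩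
  cases κ with
  | ordinary => exact isUnit_of_retract hpi hi hp hT
  | browder => exact isBrowder_iff.2 ⟨isFredholm_of_retract hpi hi hp hT.1, hD⟩
  | drazin => exact hD

theorem SpectrumKind.IsInvertible.of_restrict (h : Submodule.IsTopCompl M N)
    {hM : ∀ x ∈ M, T x ∈ M} {hN : ∀ x ∈ N, T x ∈ N} (hTM : IsUnit (T.restrict hM))
    (hTN : κ.IsInvertible (T.restrict hN)) : κ.IsInvertible T := by
  have := h.isClosed'.completeSpace_coe
  have hD : IsDrazinInvertible T :=
    exists_isDrazinInverse_of_restrict h (IsDrazinInvertible.of_isUnit hTM) hTN.isDrazinInvertible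
  cases κ with
  | ordinary => exact isUnit_of_restrict h hTM hTN
  | browder => exact isBrowder_iff.2 ⟨isFredholm_of_restrict h hTM hTN.1, hD⟩
  | drazin => exact hD

theorem SpectrumKind.spec_restrict_subset (κ : SpectrumKind) (h : Submodule.IsTopCompl M N)
    (hM : ∀ x ∈ M, T x ∈ M) (hN : ∀ x ∈ N, T x ∈ N) :
    κ.spec (T.restrict hM) ⊆ κ.spec T := fun z hz => by
  by_contra hzT
  exact notMem_spec.2
    ((notMem_spec.1 hzT).restrict h (sub_smul_one_mem hM z) (sub_smul_one_mem hN z)) hz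

theorem SpectrumKind.spec_diff_subset (κ : SpectrumKind) (h : Submodule.IsTopCompl M N)
    (hM : ∀ x ∈ M, T x ∈ M) (hN : ∀ x ∈ N, T x ∈ N) :
    κ.spec T \ spectrum ℂ (T.restrict hM) ⊆ κ.spec (T.restrict hN) := fun z hz => by
  by_contra hzN
  exact notMem_spec.2 (.of_restrict (hM := sub_smul_one_mem hM z) (hN := sub_smul_one_mem hN z) h
    (notMem_spectrum_iff_isUnit_sub_smul_one.1 hz.2) (notMem_spec.1 hzN)) hz.1

end Spec

section Decomposition

theorem isUnit_restrict_of_isProj {R X : Type*} [Semiring R] [AddCommMonoid X] [Module R X]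
    [TopologicalSpace X] {N : Submodule R X} {q u T : X →L[R] X} (hq : LinearMap.IsProj N q)
    (hT : ∀ x ∈ N, T x ∈ N) (hqu : q * u = T * q) (huq : u * q = T * q) (hu : IsUnit u) :
    IsUnit (T.restrict hT) := by
  refine isUnit_of_retract (i := N.subtypeL) (p := q.codRestrict N hq.map_mem)
    (fun y => Subtype.ext (hq.map_id y y.2)) (fun y => ?_)
    (fun x => Subtype.ext (DFunLike.congr_fun hqu x)) hu
  have huy : u (q y) = T (q y) := DFunLike.congr_fun huq (y : X)
  rw [hq.map_id y y.2] at huy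
  exact huy.symm

variable {X : Type*} [NormedAddCommGroup X] [NormedSpace ℂ X] {T p : X →L[ℂ] X}

theorem isUnit_restrict_ker (hp : IsIdempotentElem p) (hpT : Commute p T)
    (hker : ∀ x ∈ p.ker, T x ∈ p.ker) (hu : IsUnit (T * (1 - p) + p)) :
    IsUnit (T.restrict hker) := by
  have hcomm : Commute (1 - p) T := (Commute.one_left T).sub_left hpT
  have hproj : LinearMap.IsProj p.ker (1 - p) :=
    ⟨DFunLike.congr_fun hp.mul_one_sub_self,
      fun x (hx : p x = 0) => show x - p x = x by rw [hx, sub_zero]⟩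
  refine isUnit_restrict_of_isProj hproj hker ?_ ?_ hu
  · rw [mul_add, ← mul_assoc, hcomm.eq, mul_assoc, hp.one_sub.eq, hp.one_sub_mul_self, add_zero]
  · rw [add_mul, mul_assoc, hp.one_sub.eq, hp.mul_one_sub_self, add_zero]

theorem spectrum_restrict_range_subset (hp : IsIdempotentElem p) (hpT : Commute p T)
    (hrange : ∀ x ∈ p.range, T x ∈ p.range) :
    spectrum ℂ (T.restrict hrange) ⊆ spectrum ℂ (T * p) := by
  intro z hz
  by_contra hzp
  have hproj : LinearMap.IsProj p.range p :=
    ⟨fun x => ⟨x, rfl⟩, by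
      rintro _ ⟨x, rfl⟩
      exact DFunLike.congr_fun hp.eq x⟩
  refine notMem_spectrum_iff_isUnit_sub_smul_one.2 (isUnit_restrict_of_isProj hproj
    (sub_smul_one_mem hrange z) ?_ ?_ (notMem_spectrum_iff_isUnit_sub_smul_one.1 hzp)) hz
  · rw [mul_sub, sub_mul, ← mul_assoc, hpT.eq, mul_assoc, hp.eq, mul_smul_one, smul_one_mul]
  · rw [sub_mul, sub_mul, mul_assoc, hp.eq]

variable [CompleteSpace X] {κ : SpectrumKind} {β : Ordinal}

theorem exists_isTopCompl_of_disjoint_sphere {r : ℝ} (hr : 0 < r)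
    (hT : Disjoint (spectrum ℂ T) (Metric.sphere 0 r)) :
    ∃ (M N : Submodule ℂ X) (hM : ∀ x ∈ M, T x ∈ M) (hN : ∀ x ∈ N, T x ∈ N),
      Submodule.IsTopCompl M N ∧ IsUnit (T.restrict hM) ∧
      spectrum ℂ (T.restrict hN) ⊆ Metric.ball 0 r := by
  obtain ⟨p, hp, hpT, hunit, hball⟩ := exists_riesz_idempotent hr hT
  exact ⟨p.ker, p.range, apply_mem_ker_of_commute hpT, apply_mem_range_of_commute hpT,
    (ContinuousLinearMap.IsIdempotentElem.isTopCompl hp).symm,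
    isUnit_restrict_ker hp hpT _ hunit, (spectrum_restrict_range_subset hp hpT _).trans hball⟩

-- For `T : M →L[ℂ] M` with `M` a submodule, unifying the ring structures that `spectrum` and
-- `spectrum.isClosed` use is very slow; for an abstract space it is immediate.
theorem isOpen_compl_spectrum (T : X →L[ℂ] X) : IsOpen (spectrum ℂ T)ᶜ :=
  (spectrum.isClosed T).isOpen_compl

theorem HasDecomposition.zero_notMem_accIter (h : HasDecomposition κ β T) :
    0 ∉ accIter (κ.spec T) (β + 1) := by
  obtain ⟨M, N, hM, hN, hMc, hNc, hMN, hTM, hacc⟩ := h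
  have := hMc.completeSpace_coe
  have htop := Submodule.isTopCompl_iff_isCompl_isClosed.2 ⟨hMN, hMc, hNc⟩
  have hopen := isOpen_compl_spectrum (T.restrict hM)
  exact notMem_accIter_add_one_iff.2 ⟨_, hopen.mem_nhds ((spectrum.zero_notMem_iff ℂ).2 hTM),
    (accIter_inter_subset hopen (κ.spec_diff_subset htop hM hN) β).trans hacc⟩

theorem exists_disjoint_spectrum_sphere {ε : ℝ} (hε : 0 < ε)
    (h : (accIter (κ.spec T) β ∩ Metric.ball 0 ε).Countable) :
    ∃ r ∈ Ioo 0 ε, Disjoint (spectrum ℂ T) (Metric.sphere 0 r) := by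
  refine exists_disjoint_sphere_of_countable hε
    (countable_inter_of_countable_accIter_inter (spectrum.isClosed T) (fun z _ hz hacc => ?_) h)
  exact accPt_iff_frequently_nhdsNE.1 hacc (SpectrumKind.eventually_notMem_spectrum hz)

theorem HasDecomposition.of_zero_notMem_accIter (h : 0 ∉ accIter (κ.spec T) (β + 1)) :
    HasDecomposition κ β T := by
  obtain ⟨U, hU, hU0⟩ := notMem_accIter_add_one_iff.1 h
  obtain ⟨ε, hε, hεU⟩ := Metric.mem_nhds_iff.1 hU
  have hsub : accIter (κ.spec T) β ∩ Metric.ball 0 ε ⊆ {0} :=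
    (inter_subset_inter_right _ hεU).trans hU0
  obtain ⟨r, hr, hrT⟩ := exists_disjoint_spectrum_sphere hε ((countable_singleton 0).mono hsub)
  obtain ⟨M, N, hM, hN, htop, hTM, hball⟩ := exists_isTopCompl_of_disjoint_sphere hr.1 hrT
  have := htop.isClosed'.completeSpace_coe
  refine ⟨M, N, hM, hN, htop.isClosed, htop.isClosed', htop.isCompl, hTM, fun z hz => hsub ⟨?_, ?_⟩⟩
  · exact accIter_mono (κ.spec_restrict_subset htop.symm hN hM) β hz
  · exact Metric.ball_subset_ball hr.2.le
      (hball (κ.spec_subset_spectrum _ (accIter_subset (κ.isClosed_spec _) β hz)))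

theorem hasDecomposition_sub_smul_one_iff {μ : ℂ} :
    HasDecomposition κ β (T - μ • (1 : X →L[ℂ] X)) ↔ μ ∉ accIter (κ.spec T) (β + 1) := by
  have hμ : 0 ∈ accIter (κ.spec (T - μ • (1 : X →L[ℂ] X))) (β + 1) ↔
      μ ∈ accIter (κ.spec T) (β + 1) := by
    rw [SpectrumKind.spec_sub_smul_one, accIter_preimage_homeomorph, mem_preimage,
      Homeomorph.coe_addRight]
    simp only [zero_add]
  rw [← hμ]
  exact ⟨HasDecomposition.zero_notMem_accIter, HasDecomposition.of_zero_notMem_accIter⟩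

end Decomposition

theorem mainTheorem2 {X : Type*} [NormedAddCommGroup X] [NormedSpace ℂ X] [CompleteSpace X]
    (κ : SpectrumKind) (T : X →L[ℂ] X) (μ : ℂ) (α : Ordinal) :
    IsGInvertible κ α (T - μ • (1 : X →L[ℂ] X)) ↔ μ ∉ accIter (κ.spec T) α := by
  simp only [IsGInvertible, hasDecomposition_sub_smul_one_iff,
    SpectrumKind.zero_mem_spec_sub_smul_one]
  constructor
  · rintro (⟨rfl, h⟩ | ⟨β, rfl, h⟩ | ⟨hα, h⟩)
    · rwa [accIter_zero]
    · exact h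
    · exact (notMem_accIter_limit_iff (κ.isClosed_spec T) hα).2 h
  · intro h
    obtain rfl | ⟨β, rfl⟩ | hα := Ordinal.zero_or_succ_or_isSuccLimit α
    · exact .inl ⟨rfl, by rwa [accIter_zero] at h⟩
    · exact .inr (.inl ⟨β, rfl, h⟩)
    · exact .inr (.inr ⟨hα, (notMem_accIter_limit_iff (κ.isClosed_spec T) hα).1 h⟩)
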